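/- Terms are built from variables and from the function symbols of a signature $\mathcal F$; $|t|$ is the number of occurrences of variables and function symbols in $t$. A string rewrite system $R$ is a finite set of rules $l\to r$ between terms over a signature all of whose symbols have arity $0$ or $1$, where $l$ is not a variable and every variable of $r$ occurs in $l$. We write $s\to_R t$ if $s=C[l\sigma]$ and $t=C[r\sigma]$ for a context $C$, a substitution $\sigma$ and a rule $l\to r$ of $R$, and $\to_{S/R}$ for $\to_R^*\cdot\to_S\cdot\to_R^*$. For a relation $\to$, let $\mathrm{dh}(s,\to)=\max\{k\mid \exists t\; s\to^k t\}$, and let $\mathrm{dc}_R(n)=\max\{\mathrm{dh}(t,\to_R)\mid |t|\le n\}$, where the maximum of the empty set is $0$. For each symbol $f$ let $f^\sharp$ be a fresh symbol of the same arity, put $f(t_1,\dots,t_k)^\sharp=f^\sharp(t_1,\dots,t_k)$ and $x^\sharp=x$ for variables $x$, and let $\mathrm{DP}(R)$ be the set of rules $l^\sharp\to u^\sharp$ such that $l\to r$ is a rule of $R$, $u$ is a subterm of $r$ whose root symbol is the root symbol of a left-hand side of $R$, and $u$ is not a proper subterm of $l$. Theorem. Let $R$ be a terminating string rewrite system. For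 every $n\in\mathbb N$ and every term $s$ put $$f(n)=\max\{\mathrm{dh}(t^\sharp,\to_{\mathrm{DP}(R)/R})\mid |t|\le n\},\qquad f(s)=\max\{\mathrm{dh}(t^\sharp,\to_{\mathrm{DP}(R)/R})\mid t \text{ a subterm of } s\}$$ (with $t$ ranging over terms over $\mathcal F$). These maxima are finite, and there is $d\in\mathbb N$, depending only on $R$, such that $$\mathrm{dh}(s,\to_R)\le |s|\cdot 2^{d\cdot(f(s)+1)}\ \text{ for all terms } s,\qquad \mathrm{dc}_R(n)\le n\cdot 2^{d\cdot(f(n)+1)}\ \text{ for all } n\in\mathbb N .$$ The bound is tight: the system $R_e=\{\mathsf f(\mathsf s(x))\to \mathsf s(\mathsf f(\mathsf f(x)))\}$ over the unary symbols $\mathsf f,\mathsf s$ and a constant $0$ is a terminating string rewrite system whose dependency pair complexity is at most linear, $f(n)\le n$ for all $n$, and whose derivational complexity is at least exponential, $\mathrm{dc}_{R_e}(n+2)\ge 2^n-1$ for all $n$. -/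

import Mathlib

universe u v w

namespace Rewriting

/-! ### Terms, contexts, subterms

Signatures are the function symbols of a first-order language `L`, and `L.Term V` is the set of
terms over `L` with variables in `V`; `Term.subst` is the application of a substitution. -/

section Terms

variable {L : FirstOrder.Language.{u, v}} {V : Type w}

/-- The number of variables and function symbols occurring in a term. -/
def size : L.Term V → ℕ
  | .var _ => 1
  | .func _ ts => 1 + ∑ i, size (ts i)

/-- The variables occurring in a term. -/
def vars : L.Term V → Set V
  | .var x => {x}
  | .func _ ts => ⋃ i, vars (ts i)

/-- The root symbol of a term: a variable or a function symbol (together with its arity). -/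
def root : L.Term V → V ⊕ (Σ n, L.Functions n)
  | .var x => Sum.inl x
  | .func f _ => Sum.inr ⟨_, f⟩

variable (L V) in
/-- Terms with exactly one hole. In `Context.arg f i ts C` the hole lies in the `i`-th argument,
which is `C`; the other arguments are given by `ts` (and the value `ts i` is ignored). -/
inductive Context : Type (max u w)
  | hole : Context
  | arg {n : ℕ} (f : L.Functions n) (i : Fin n) (ts : Fin n → L.Term V) (C : Context) : Context

/-- `C.fill t` is `C[t]`. -/
def Context.fill : Context L V → L.Term V → L.Term V
  | .hole, t => t
  | .arg f i ts C, t => .func f (Function.update ts i (C.fill t))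

/-- `u` is a subterm of `t`. -/
def Subterm (u t : L.Term V) : Prop := ∃ C : Context L V, C.fill u = t

/-- `u` is a proper subterm of `t`. -/
def ProperSubterm (u t : L.Term V) : Prop := Subterm u t ∧ u ≠ t

end Terms

/-! ### Abstract rewriting -/

section Relations

variable {α : Type w}

/-- The `n`-fold composition of a relation with itself. -/
def relPow (r : α → α → Prop) : ℕ → α → α → Prop
  | 0, a, b => a = b
  | n + 1, a, b => ∃ c, r a c ∧ relPow r n c b

/-- There is no infinite chain `a₀ → a₁ → a₂ → ⋯`. -/
def Terminating (r : α → α → Prop) : Prop :=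
  ¬ ∃ a : ℕ → α, ∀ i, r (a i) (a (i + 1))

/-- The derivation height of `a`: the supremum in `ℕ ∪ {∞}` of the lengths of the derivations
that start in `a`. -/
noncomputable def derivationHeight (r : α → α → Prop) (a : α) : ℕ∞ :=
  ⨆ (n : ℕ) (_ : ∃ b, relPow r n a b), (n : ℕ∞)

/-- The relative relation `r / s`, that is `s* · r · s*`. -/
def Relative (r s : α → α → Prop) (a b : α) : Prop :=
  ∃ c d, Relation.ReflTransGen s a c ∧ r c d ∧ Relation.ReflTransGen s d b

end Relations

/-! ### Term rewrite systems -/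

section TRS

variable {L : FirstOrder.Language.{u, v}} {V : Type w}

/-- A term rewrite system is a finite set of rules `l → r`, written as pairs `(l, r)`, such that
`l` is not a variable and every variable of `r` occurs in `l`. -/
structure IsTRS (R : Set (L.Term V × L.Term V)) : Prop where
  finite : R.Finite
  lhs_ne_var : ∀ ρ ∈ R, ∀ x : V, ρ.1 ≠ .var x
  vars_subset : ∀ ρ ∈ R, vars ρ.2 ⊆ vars ρ.1

variable (L) in
/-- All function symbols are unary or nullary. -/
def IsStringSignature : Prop := ∀ n, 2 ≤ n → IsEmpty (L.Functions n)

/-- The rewrite relation: `s = C[lσ]` and `t = C[rσ]` for a rule `l → r`. -/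
def Rewrites (R : Set (L.Term V × L.Term V)) (s t : L.Term V) : Prop :=
  ∃ (C : Context L V) (σ : V → L.Term V), ∃ ρ ∈ R,
    s = C.fill (ρ.1.subst σ) ∧ t = C.fill (ρ.2.subst σ)

/-- The defined function symbols: the roots of left-hand sides. -/
def definedSymbols (R : Set (L.Term V × L.Term V)) : Set (Σ n, L.Functions n) :=
  {f | ∃ ρ ∈ R, root ρ.1 = Sum.inr f}

/-- The derivational complexity function. -/
noncomputable def derivationalComplexity (R : Set (L.Term V × L.Term V)) (n : ℕ) : ℕ∞ :=
  ⨆ (t : L.Term V) (_ : size t ≤ n), derivationHeight (Rewrites R) t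

/-! ### Dependency pairs

The signature extended by a fresh symbol `f♯` of the same arity for each `f` is `L.sum L`:
the left copy consists of the original symbols and the right copy of the symbols `f♯`. -/

/-- A term over the original signature, seen as a term over the extended one. -/
def embed (t : L.Term V) : (L.sum L).Term V := FirstOrder.Language.LHom.sumInl.onTerm t

/-- `t♯`: the root symbol `f` is replaced by `f♯`; variables are unchanged. -/
def sharp : L.Term V → (L.sum L).Term V
  | .var x => .var x
  | .func f ts => .func (Sum.inr f) (fun i => embed (ts i))

/-- The rules of `R`, seen over the extended signature. -/
def embedRules (R : Set (L.Term V × L.Term V)) :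
    Set ((L.sum L).Term V × (L.sum L).Term V) :=
  (fun ρ => (embed ρ.1, embed ρ.2)) '' R

/-- The dependency pairs `l♯ → u♯`, where `l → r` is a rule and `u` is a subterm of `r` with
defined root that is not a proper subterm of `l`. -/
def dependencyPairs (R : Set (L.Term V × L.Term V)) :
    Set ((L.sum L).Term V × (L.sum L).Term V) :=
  {π | ∃ ρ ∈ R, ∃ u, Subterm u ρ.2 ∧ (∃ f ∈ definedSymbols R, root u = Sum.inr f) ∧
    ¬ ProperSubterm u ρ.1 ∧ π = (sharp ρ.1, sharp u)}

/-- The derivation height of `t♯` with respect to `DP(R) / R`. -/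
noncomputable def dpHeight (R : Set (L.Term V × L.Term V)) (t : L.Term V) : ℕ∞ :=
  derivationHeight (Relative (Rewrites (dependencyPairs R)) (Rewrites (embedRules R))) (sharp t)

/-- The dependency pair complexity function `n ↦ max {dh(t♯, DP(R) / R) | |t| ≤ n}`. -/
noncomputable def dpComplexity (R : Set (L.Term V × L.Term V)) (n : ℕ) : ℕ∞ :=
  ⨆ (t : L.Term V) (_ : size t ≤ n), dpHeight R t

/-- The dependency pair complexity of a term, `s ↦ max {dh(t♯, DP(R) / R) | t subterm of s}`. -/
noncomputable def dpComplexityOf (R : Set (L.Term V × L.Term V)) (s : L.Term V) : ℕ∞ :=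
  ⨆ (t : L.Term V) (_ : Subterm t s), dpHeight R t

end TRS

/-! ### The system with the single rule `f(s(x)) → s(f(f(x)))` -/

/-- A constant `zero` and two unary symbols `s` and `f`. -/
inductive ExpSymbol : ℕ → Type
  | zero : ExpSymbol 0
  | s : ExpSymbol 1
  | f : ExpSymbol 1

/-- The signature with function symbols `ExpSymbol` (and no relation symbols). -/
def expSignature : FirstOrder.Language.{0, 0} := ⟨ExpSymbol, fun _ => Empty⟩

/-- The term `s(t)`. -/
def expS (t : expSignature.Term ℕ) : expSignature.Term ℕ :=
  .func (l := 1) ExpSymbol.s (fun _ => t)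

/-- The term `f(t)`. -/
def expF (t : expSignature.Term ℕ) : expSignature.Term ℕ :=
  .func (l := 1) ExpSymbol.f (fun _ => t)

/-- The system `{f(s(x)) → s(f(f(x)))}`. -/
def expSystem : Set (expSignature.Term ℕ × expSignature.Term ℕ) :=
  {(expF (expS (.var 0)), expS (expF (expF (.var 0))))}

end Rewriting

namespace Rewriting

open FirstOrder.Language

/-! ### Derivation heights -/

section Relations

variable {α : Type*} {r : α → α → Prop}

/-! The upper bound comes from a weight that every rewrite step decreases. Each occurrence of a
defined symbol, as the root of a subterm `u`, contributes `2 ^ (d * dpHeight R u)`. Consider a step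
`C[lσ] → C[rσ]` with `k` the `dpHeight` of `lσ`. Symbols in `C` above the hole do not gain weight,
because `DP(R) / R` absorbs steps of `R` below the root (`dpHeight_le_of_rewrites_arg`). Parts of
`r` that are proper subterms of `l`, in particular its variables, are already paid for by the
arguments of `l`; they are counted only once, because a string has no branching. Every other defined
symbol in `r` is the target of a dependency pair, so its `dpHeight` is below `k`
(`dpHeight_add_one_le`). Hence at most `size r` summands, each at most `2 ^ (d * (k - 1))`, replace
the summand `2 ^ (d * k)` of the root of `lσ`, and `size r < 2 ^ d` makes this a strict decrease
(`weight_subst_le`, `weight_lt_of_rewrites`).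

The maxima are finite because erasing marks turns a chain of dependency pairs into a derivation of
`R` (`dpHeight_le_derivationHeight`), derivation heights are finite by König's lemma, and up to
irrelevant symbols and variables there are finitely many terms of each size
(`derivationalComplexity_ne_top`).

For the example, dependency pairs consume a symbol `s` while the rule preserves their number, so
chains are linear. Moving one `f` across an `s` doubles it, so derivations are exponential. -/

theorem le_derivationHeight {n : ℕ} {a b : α} (h : relPow r n a b) :
    (n : ℕ∞) ≤ derivationHeight r a :=
  le_iSup₂_of_le n ⟨b, h⟩ le_rfl

theorem derivationHeight_le {a : α} {k : ℕ∞}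
    (h : ∀ (n : ℕ) b, relPow r n a b → (n : ℕ∞) ≤ k) : derivationHeight r a ≤ k :=
  iSup₂_le fun n ⟨b, hb⟩ => h n b hb

theorem relPow_trans {m n : ℕ} {a b c : α} (hab : relPow r m a b) (hbc : relPow r n b c) :
    relPow r (m + n) a c := by
  induction m generalizing a with
  | zero => cases hab; simpa using hbc
  | succ m ih =>
    obtain ⟨a', h, h'⟩ := hab
    rw [Nat.succ_add]
    exact ⟨a', h, ih h'⟩

/-- A measure that every step decreases bounds the derivation height. -/
theorem derivationHeight_le_measure (m : α → ℕ) (hm : ∀ a b, r a b → m b < m a) (a : α) :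
    derivationHeight r a ≤ m a := by
  refine derivationHeight_le fun n b h => ?_
  norm_cast
  induction n generalizing a with
  | zero => exact Nat.zero_le _
  | succ n ih =>
    obtain ⟨c, hac, hcb⟩ := h
    have h₁ := hm a c hac
    have h₂ := ih c hcb
    omega

theorem terminating_of_measure (m : α → ℕ) (hm : ∀ a b, r a b → m b < m a) :
    Terminating r := by
  rintro ⟨a, ha⟩
  have h : ∀ i, m (a i) + i ≤ m (a 0) := by
    intro i
    induction i with
    | zero => simp
    | succ i ih => have := hm _ _ (ha i); omega
  have := h (m (a 0) + 1)
  omega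

theorem derivationHeight_add_one_le {a b : α} (h : r a b) :
    derivationHeight r b + 1 ≤ derivationHeight r a := by
  by_cases htop : derivationHeight r a = ⊤
  · simp [htop]
  obtain ⟨k, hk⟩ := ENat.ne_top_iff_exists.1 htop
  rw [← hk]
  have hle : ∀ (n : ℕ) c, relPow r n b c → n + 1 ≤ k := by
    intro n c hc
    have := le_derivationHeight (r := r) (n := n + 1) (a := a) ⟨b, h, hc⟩
    rw [← hk] at this
    exact_mod_cast this
  have hk1 : 1 ≤ k := by simpa using hle 0 b rfl
  obtain ⟨j, rfl⟩ : ∃ j, k = j + 1 := ⟨k - 1, by omega⟩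
  push_cast
  gcongr
  refine derivationHeight_le fun n c hc => ?_
  have := hle n c hc
  exact_mod_cast (by omega : n ≤ j)

/-- Only the first step of a derivation sees its starting point, so a nonempty derivation from `b`
can be rerouted to start in `a`. -/
theorem derivationHeight_mono {a b : α} (h : ∀ c, r b c → r a c) :
    derivationHeight r b ≤ derivationHeight r a := by
  refine derivationHeight_le fun n c hc => ?_
  cases n with
  | zero => simp
  | succ n =>
    obtain ⟨d, hd, hdc⟩ := hc
    exact le_derivationHeight (b := c) ⟨d, h _ hd, hdc⟩

/-- For a finitely branching terminating relation, derivation heights are finite. -/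
theorem derivationHeight_ne_top (hfin : ∀ a, {b | r a b}.Finite) (ht : Terminating r) (a : α) :
    derivationHeight r a ≠ ⊤ := by
  intro ha
  -- König's lemma: if all of the finitely many successors had finite height, a common bound `N`
  -- would bound the height of `a` by `N + 1`. Iterating the choice of a successor of infinite
  -- height contradicts termination.
  have step : ∀ a : {a // derivationHeight r a = ⊤}, ∃ b : {b // derivationHeight r b = ⊤},
      r a b := by
    rintro ⟨a, ha⟩
    by_contra! hcon
    have hb : ∀ b, r a b → derivationHeight r b ≠ ⊤ := fun b hab hb => hcon ⟨b, hb⟩ hab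
    obtain ⟨N, hN⟩ : ∃ N : ℕ, ∀ b, r a b → derivationHeight r b ≤ N := by
      obtain ⟨N, hN⟩ := ((hfin a).image fun b => (derivationHeight r b).toNat).bddAbove
      refine ⟨N, fun b hab => ?_⟩
      rw [← ENat.natCast_toNat (hb b hab)]
      exact_mod_cast hN ⟨b, hab, rfl⟩
    have : derivationHeight r a ≤ ((N + 1 : ℕ) : ℕ∞) := by
      refine derivationHeight_le fun n c hc => ?_
      cases n with
      | zero => simp
      | succ n =>
        obtain ⟨d, hd, hdc⟩ := hc
        have : n ≤ N := by exact_mod_cast (le_derivationHeight hdc).trans (hN d hd)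
        exact_mod_cast (by omega : n + 1 ≤ N + 1)
    rw [ha] at this
    exact ENat.natCast_ne_top _ (top_le_iff.1 this)
  choose g hg using step
  exact ht ⟨fun i => (g^[i] ⟨a, ha⟩).1, fun i => by
    simp only [Function.iterate_succ_apply']; exact hg _⟩

end Relations

/-! ### Terms and contexts -/

section Terms

variable {L : FirstOrder.Language.{u, v}} {V : Type w}

/-- Composition of contexts. -/
def Context.comp : Context L V → Context L V → Context L V
  | .hole, D => D
  | .arg f i ts C, D => .arg f i ts (C.comp D)

theorem Context.fill_comp (C D : Context L V) (t : L.Term V) :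
    (C.comp D).fill t = C.fill (D.fill t) := by
  induction C with
  | hole => rfl
  | arg f i ts C ih => simp [Context.comp, Context.fill, ih]

theorem Subterm.refl (t : L.Term V) : Subterm t t := ⟨.hole, rfl⟩

theorem Subterm.trans {a b c : L.Term V} (hab : Subterm a b) (hbc : Subterm b c) :
    Subterm a c := by
  obtain ⟨C, rfl⟩ := hab
  obtain ⟨D, rfl⟩ := hbc
  exact ⟨D.comp C, Context.fill_comp _ _ _⟩

theorem subterm_arg {n : ℕ} (f : L.Functions n) (ts : Fin n → L.Term V) (i : Fin n) :
    Subterm (ts i) (.func f ts) :=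
  ⟨.arg f i ts .hole, by simp [Context.fill]⟩

theorem size_arg_lt {n : ℕ} (f : L.Functions n) (ts : Fin n → L.Term V) (i : Fin n) :
    size (ts i) < size (.func f ts) := by
  have := Finset.single_le_sum (f := fun i => size (ts i)) (fun _ _ => Nat.zero_le _)
    (Finset.mem_univ i)
  simp only [size] at *
  omega

theorem Subterm.size_le {u t : L.Term V} (h : Subterm u t) : size u ≤ size t := by
  obtain ⟨C, rfl⟩ := h
  induction C with
  | hole => exact le_rfl
  | arg f i ts C ih =>
    have := size_arg_lt f (Function.update ts i (C.fill u)) i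
    simp only [Function.update_self] at this
    exact ih.trans this.le

theorem Subterm.vars_subset {u t : L.Term V} (h : Subterm u t) : vars u ⊆ vars t := by
  obtain ⟨C, rfl⟩ := h
  induction C with
  | hole => exact le_rfl
  | arg f i ts C ih =>
    refine ih.trans fun x hx => ?_
    simp only [Context.fill, vars, Set.mem_iUnion]
    exact ⟨i, by simpa using hx⟩

theorem subterm_var_of_mem_vars {x : V} {t : L.Term V} (h : x ∈ vars t) :
    Subterm (.var x) t := by
  induction t with
  | var y => cases h; exact Subterm.refl _
  | func f ts ih =>
    obtain ⟨i, hi⟩ := Set.mem_iUnion.1 h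
    exact (ih i hi).trans (subterm_arg f ts i)

theorem ProperSubterm.exists_arg {u : L.Term V} {n : ℕ} {f : L.Functions n}
    {ts : Fin n → L.Term V} (h : ProperSubterm u (.func f ts)) : ∃ i, Subterm u (ts i) := by
  obtain ⟨⟨C, hC⟩, hne⟩ := h
  cases C with
  | hole => exact absurd hC hne
  | arg g i ss C =>
    simp only [Context.fill] at hC
    cases hC
    exact ⟨i, C, by simp⟩

theorem exists_context_subst (σ : V → L.Term V) (C : Context L V) :
    ∃ D : Context L V, ∀ t, (C.fill t).subst σ = D.fill (t.subst σ) := by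
  induction C with
  | hole => exact ⟨.hole, fun _ => rfl⟩
  | arg f i ts C ih =>
    obtain ⟨D, hD⟩ := ih
    refine ⟨.arg f i (fun j => (ts j).subst σ) D, fun t => ?_⟩
    simp only [Context.fill, Term.subst, ← hD]
    congr 1
    ext1 j
    rcases eq_or_ne j i with rfl | h <;> simp [*]

theorem Subterm.subst {u t : L.Term V} (h : Subterm u t) (σ : V → L.Term V) :
    Subterm (u.subst σ) (t.subst σ) := by
  obtain ⟨C, rfl⟩ := h
  obtain ⟨D, hD⟩ := exists_context_subst σ C
  exact ⟨D, (hD u).symm⟩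

theorem subst_subst (t : L.Term V) (σ τ : V → L.Term V) :
    (t.subst σ).subst τ = t.subst fun x => (σ x).subst τ := by
  induction t with
  | var x => rfl
  | func f ts ih => simp [Term.subst, ih]

theorem subst_congr {t : L.Term V} {σ τ : V → L.Term V} (h : ∀ x ∈ vars t, σ x = τ x) :
    t.subst σ = t.subst τ := by
  induction t with
  | var x => exact h x rfl
  | func f ts ih =>
    simp only [Term.subst]
    congr 1
    ext1 i
    exact ih i fun x hx => h x (Set.mem_iUnion.2 ⟨i, hx⟩)

theorem eq_of_subst_eq {t : L.Term V} {σ τ : V → L.Term V} (h : t.subst σ = t.subst τ) :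
    ∀ x ∈ vars t, σ x = τ x := by
  induction t with
  | var y => rintro x rfl; exact h
  | func f ts ih =>
    intro x hx
    obtain ⟨i, hi⟩ := Set.mem_iUnion.1 hx
    simp only [Term.subst, Term.func.injEq, heq_eq_eq, true_and] at h
    exact ih i (congrFun h i) x hi

/-! ### Terms and contexts under maps of signatures -/

section Maps

variable {L' : FirstOrder.Language.{u, v}}

theorem onTerm_subst (φ : L →ᴸ L') (t : L.Term V) (σ : V → L.Term V) :
    φ.onTerm (t.subst σ) = (φ.onTerm t).subst fun x => φ.onTerm (σ x) := by
  induction t with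
  | var x => rfl
  | func f ts ih => simp [Term.subst, LHom.onTerm, ih]

theorem onTerm_func_update (φ : L →ᴸ L') {n : ℕ} (f : L.Functions n) (i : Fin n)
    (ts : Fin n → L.Term V) (t : L.Term V) :
    φ.onTerm (.func f (Function.update ts i t)) =
      .func (φ.onFunction f) (Function.update (fun j => φ.onTerm (ts j)) i (φ.onTerm t)) := by
  simp only [LHom.onTerm]
  congr 1
  ext1 j
  rcases eq_or_ne j i with rfl | h <;> simp [*]

theorem exists_context_onTerm (φ : L →ᴸ L') (C : Context L V) :
    ∃ D : Context L' V, ∀ t, φ.onTerm (C.fill t) = D.fill (φ.onTerm t) := by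
  induction C with
  | hole => exact ⟨.hole, fun _ => rfl⟩
  | arg f i ts C ih =>
    obtain ⟨D, hD⟩ := ih
    refine ⟨.arg (φ.onFunction f) i (fun j => φ.onTerm (ts j)) D, fun t => ?_⟩
    simp only [Context.fill, ← hD, onTerm_func_update]

end Maps

end Terms

/-! ### Rewriting -/

section Rewriting

variable {L : FirstOrder.Language.{u, v}} {V : Type w} {R : Set (L.Term V × L.Term V)}

theorem Rewrites.fill {s t : L.Term V} (h : Rewrites R s t) (C : Context L V) :
    Rewrites R (C.fill s) (C.fill t) := by
  obtain ⟨D, σ, ρ, hρ, rfl, rfl⟩ := h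
  exact ⟨C.comp D, σ, ρ, hρ, (Context.fill_comp _ _ _).symm, (Context.fill_comp _ _ _).symm⟩

theorem Rewrites.subst {s t : L.Term V} (h : Rewrites R s t) (τ : V → L.Term V) :
    Rewrites R (s.subst τ) (t.subst τ) := by
  obtain ⟨C, σ, ρ, hρ, rfl, rfl⟩ := h
  obtain ⟨D, hD⟩ := exists_context_subst τ C
  exact ⟨D, fun x => (σ x).subst τ, ρ, hρ, by rw [hD, subst_subst], by rw [hD, subst_subst]⟩

theorem Rewrites.onTerm {L' : FirstOrder.Language.{u, v}} {R' : Set (L'.Term V × L'.Term V)}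
    (φ : L →ᴸ L') (hφ : ∀ ρ ∈ R, (φ.onTerm ρ.1, φ.onTerm ρ.2) ∈ R') {s t : L.Term V}
    (h : Rewrites R s t) : Rewrites R' (φ.onTerm s) (φ.onTerm t) := by
  obtain ⟨C, σ, ρ, hρ, rfl, rfl⟩ := h
  obtain ⟨D, hD⟩ := exists_context_onTerm φ C
  exact ⟨D, fun x => φ.onTerm (σ x), _, hφ ρ hρ, by rw [hD, onTerm_subst],
    by rw [hD, onTerm_subst]⟩

/-- A root step or a step in one of the arguments. -/
theorem Rewrites.cases {s t : L.Term V} (h : Rewrites R s t) :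
    (∃ ρ ∈ R, ∃ σ, s = ρ.1.subst σ ∧ t = ρ.2.subst σ) ∨
    ∃ (n : ℕ) (f : L.Functions n) (ts : Fin n → L.Term V) (i : Fin n) (t' : L.Term V),
      Rewrites R (ts i) t' ∧ s = .func f ts ∧ t = .func f (Function.update ts i t') := by
  obtain ⟨C, σ, ρ, hρ, rfl, rfl⟩ := h
  cases C with
  | hole => exact Or.inl ⟨ρ, hρ, σ, rfl, rfl⟩
  | arg f i ts C =>
    refine Or.inr ⟨_, f, Function.update ts i (C.fill (ρ.1.subst σ)), i,
      C.fill (ρ.2.subst σ), ?_, rfl, ?_⟩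
    · rw [Function.update_self]
      exact ⟨C, σ, ρ, hρ, rfl, rfl⟩
    · simp [Context.fill]

/-- Matching determines the substitution on the variables of the left-hand side, hence on those of
the right-hand side, so each rule yields at most one result at the root. -/
theorem finite_root_successors (hR : IsTRS R) (s : L.Term V) :
    {t | ∃ ρ ∈ R, ∃ σ, s = ρ.1.subst σ ∧ t = ρ.2.subst σ}.Finite := by
  have : {t | ∃ ρ ∈ R, ∃ σ, s = ρ.1.subst σ ∧ t = ρ.2.subst σ} =
      ⋃ ρ ∈ R, {t | ∃ σ, s = ρ.1.subst σ ∧ t = ρ.2.subst σ} := by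
    ext t; simp
  rw [this]
  refine hR.finite.biUnion fun ρ hρ => Set.Subsingleton.finite ?_
  rintro _ ⟨σ, h, rfl⟩ _ ⟨τ, h', rfl⟩
  exact subst_congr fun x hx => eq_of_subst_eq (h.symm.trans h') x (hR.vars_subset ρ hρ hx)

theorem finite_successors (hR : IsTRS R) (s : L.Term V) : {t | Rewrites R s t}.Finite := by
  induction s with
  | var x =>
    refine (finite_root_successors hR (.var x)).subset fun t ht => ?_
    rcases Rewrites.cases ht with h | ⟨n, f, ts, i, t', -, h, -⟩
    · exact h
    · cases h
  | func f ts ih =>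
    refine ((finite_root_successors hR (.func f ts)).union
      (Set.finite_iUnion fun i => (ih i).image fun t' =>
        Term.func f (Function.update ts i t'))).subset fun t ht => ?_
    rcases Rewrites.cases ht with h | ⟨n, g, ss, i, t', h, h', rfl⟩
    · exact Or.inl h
    · cases h'
      exact Or.inr (Set.mem_iUnion.2 ⟨i, t', h, rfl⟩)

/-- Simulated derivations are at most as long. -/
theorem derivationHeight_le_of_simulation {α β : Type*} {r : α → α → Prop} {q : β → β → Prop}
    (m : α → β) (hm : ∀ a b, r a b → q (m a) (m b)) (a : α) :
    derivationHeight r a ≤ derivationHeight q (m a) := by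
  have : ∀ (n : ℕ) a b, relPow r n a b → relPow q n (m a) (m b) := by
    intro n
    induction n with
    | zero => rintro a b rfl; rfl
    | succ n ih => rintro a b ⟨c, hac, hcb⟩; exact ⟨m c, hm _ _ hac, ih _ _ hcb⟩
  exact derivationHeight_le fun n b h => le_derivationHeight (this n a b h)

end Rewriting

/-! ### Finiteness of the derivational complexity

Symbols that do not occur in the rules can be identified with each other, and so can the
variables; this leaves finitely many terms of each size. -/

section Finiteness

variable {L : FirstOrder.Language.{u, v}} {V : Type w} {R : Set (L.Term V × L.Term V)}

/-- The function symbols that occur in a term. -/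
def symbols : L.Term V → Set (Σ n, L.Functions n)
  | .var _ => ∅
  | .func f ts => {⟨_, f⟩} ∪ ⋃ i, symbols (ts i)

theorem finite_symbols (t : L.Term V) : (symbols t).Finite := by
  induction t with
  | var x => exact Set.finite_empty
  | func f ts ih => exact (Set.finite_singleton _).union (Set.finite_iUnion ih)

open Classical in
/-- Identifies all symbols of the same arity outside of `F`. -/
noncomputable def collapse (F : Set (Σ n, L.Functions n)) : L →ᴸ L where
  onFunction := fun {n} f =>
    -- By proof irrelevance `Classical.choice ⟨f⟩` depends only on the arity `n`, not on `f`.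
    if (⟨n, f⟩ : Σ n, L.Functions n) ∈ F then f else Classical.choice ⟨f⟩
  onRelation := fun {_} r => r

theorem collapse_onTerm {F : Set (Σ n, L.Functions n)} {t : L.Term V} (h : symbols t ⊆ F) :
    (collapse F).onTerm t = t := by
  induction t with
  | var x => rfl
  | func f ts ih =>
    have hf : (⟨_, f⟩ : Σ n, L.Functions n) ∈ F := h (Or.inl rfl)
    simp only [LHom.onTerm]
    congr 1
    · simp [collapse, hf]
    · ext1 i
      exact ih i fun g hg => h (Or.inr (Set.mem_iUnion.2 ⟨i, hg⟩))

/-- Collapses the symbols outside of `F`, and all variables. -/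
noncomputable def collapseTerm (F : Set (Σ n, L.Functions n)) (t : L.Term V) : L.Term V :=
  ((collapse F).onTerm t).subst fun x => .var (Classical.choice ⟨x⟩)

theorem finite_range_collapse {F : Set (Σ n, L.Functions n)} (hF : F.Finite) (n : ℕ) :
    (Set.range fun f : L.Functions n => (collapse F).onFunction f).Finite := by
  have h₁ : ((Sigma.mk n) ⁻¹' F : Set (L.Functions n)).Finite :=
    hF.preimage sigma_mk_injective.injOn
  have h₂ : (Set.range fun f : L.Functions n => (Classical.choice ⟨f⟩ : L.Functions n)).Finite :=
    Set.Subsingleton.finite (by rintro _ ⟨f, rfl⟩ _ ⟨g, rfl⟩; rfl)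
  refine (h₁.union h₂).subset ?_
  rintro _ ⟨f, rfl⟩
  by_cases hf : (⟨n, f⟩ : Σ n, L.Functions n) ∈ F
  · left; simp [collapse, hf]
  · right; exact ⟨f, by simp [collapse, hf]⟩

/-- Induction on the size bound: only the arities `0` and `1` occur, and each has finitely many
collapsed symbols. -/
theorem finite_collapseTerm_size_le (hL : IsStringSignature L) {F : Set (Σ n, L.Functions n)}
    (hF : F.Finite) (N : ℕ) : (collapseTerm F '' {t : L.Term V | size t ≤ N}).Finite := by
  induction N with
  | zero =>
    refine Set.finite_empty.subset ?_
    rintro _ ⟨t, ht, rfl⟩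
    cases t <;> simp [size] at ht
  | succ N ih =>
    have hvar : (Set.range fun x : V =>
        (Term.var (Classical.choice ⟨x⟩) : L.Term V)).Finite :=
      Set.Subsingleton.finite (by rintro _ ⟨f, rfl⟩ _ ⟨g, rfl⟩; rfl)
    have hfun : ∀ n : ℕ, (Set.image2 (fun (f : L.Functions n) ts => Term.func f ts)
        (Set.range fun f : L.Functions n => (collapse F).onFunction f)
        (Set.pi Set.univ fun _ : Fin n => collapseTerm F '' {t : L.Term V | size t ≤ N})).Finite :=
      fun n => (finite_range_collapse hF n).image2 _ (Set.Finite.pi fun _ => ih)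
    refine (hvar.union ((hfun 0).union (hfun 1))).subset ?_
    rintro _ ⟨t, ht, rfl⟩
    cases t with
    | var x => exact Or.inl ⟨x, rfl⟩
    | @func n f ts =>
      have hmem : collapseTerm F (.func f ts) ∈
          Set.image2 (fun (f : L.Functions n) ts => Term.func f ts)
            (Set.range fun f : L.Functions n => (collapse F).onFunction f)
            (Set.pi Set.univ fun _ : Fin n =>
              collapseTerm F '' {t : L.Term V | size t ≤ N}) := by
        refine ⟨_, ⟨f, rfl⟩, fun i => collapseTerm F (ts i), ?_, rfl⟩
        intro i _
        refine ⟨ts i, ?_, rfl⟩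
        have := size_arg_lt f ts i
        simp only [Set.mem_ofPred_eq] at ht ⊢
        omega
      match n, f, ts, hmem with
      | 0, _, _, hmem => exact Or.inr (Or.inl hmem)
      | 1, _, _, hmem => exact Or.inr (Or.inr hmem)
      | n + 2, f, _, _ => exact ((hL (n + 2) (by omega)).false f).elim

/-- With `F` the symbols of the rules, collapsing fixes every rule and thus maps derivations to
derivations of equal length. The supremum is therefore controlled by finitely many collapsed terms.
-/
theorem derivationalComplexity_ne_top (hL : IsStringSignature L) (hR : IsTRS R)
    (ht : Terminating (Rewrites R)) (N : ℕ) : derivationalComplexity R N ≠ ⊤ := by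
  set F : Set (Σ n, L.Functions n) := ⋃ ρ ∈ R, symbols ρ.1 ∪ symbols ρ.2 with hFdef
  have hF : F.Finite := hR.finite.biUnion fun ρ _ => (finite_symbols _).union (finite_symbols _)
  have hfix : ∀ ρ ∈ R, ((collapse F).onTerm ρ.1, (collapse F).onTerm ρ.2) ∈ R := by
    intro ρ hρ
    have hsub : symbols ρ.1 ∪ symbols ρ.2 ⊆ F :=
      Set.subset_biUnion_of_mem (u := fun ρ : L.Term V × L.Term V => symbols ρ.1 ∪ symbols ρ.2) hρ
    rw [collapse_onTerm (Set.subset_union_left.trans hsub),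
      collapse_onTerm (Set.subset_union_right.trans hsub)]
    exact hρ
  have hle : ∀ t, derivationHeight (Rewrites R) t ≤
      derivationHeight (Rewrites R) (collapseTerm F t) :=
    derivationHeight_le_of_simulation _ fun a b hab => (hab.onTerm _ hfix).subst _
  obtain ⟨M, hM⟩ := ((finite_collapseTerm_size_le (V := V) hL hF N).image
    fun t => (derivationHeight (Rewrites R) t).toNat).bddAbove
  refine ne_top_of_le_ne_top (ENat.natCast_ne_top M) (iSup₂_le fun t hN => (hle t).trans ?_)
  rw [← ENat.natCast_toNat (derivationHeight_ne_top (finite_successors hR) ht (collapseTerm F t))]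
  exact_mod_cast hM ⟨_, ⟨t, hN, rfl⟩, rfl⟩

end Finiteness

/-! ### Dependency pairs -/

section DependencyPairs

variable {L : FirstOrder.Language.{u, v}} {V : Type w} {R : Set (L.Term V × L.Term V)}

/-- Forgets the marks of all symbols. -/
def unmark (t : (L.sum L).Term V) : L.Term V :=
  (LHom.sumElim (LHom.id L) (LHom.id L)).onTerm t

/-- No symbol of the term is marked. -/
def Unmarked : (L.sum L).Term V → Prop
  | .var _ => True
  | .func f ts => (∃ g, f = Sum.inl g) ∧ ∀ i, Unmarked (ts i)

/-- The root symbol of the term is marked, and no other symbol is. -/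
def RootMarked : (L.sum L).Term V → Prop
  | .var _ => False
  | .func f ts => (∃ g, f = Sum.inr g) ∧ ∀ i, Unmarked (ts i)

theorem unmark_embed (t : L.Term V) : unmark (embed t) = t := by
  induction t with
  | var x => rfl
  | func f ts ih =>
    simp only [unmark, embed] at ih
    simp [unmark, embed, LHom.onTerm, ih]

theorem unmark_sharp (t : L.Term V) : unmark (sharp t) = t := by
  cases t with
  | var x => rfl
  | func f ts =>
    have := fun i => unmark_embed (ts i)
    simp only [unmark] at this
    simp [unmark, sharp, LHom.onTerm, this]

theorem unmarked_embed (t : L.Term V) : Unmarked (embed t) := by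
  induction t with
  | var x => trivial
  | func f ts ih => exact ⟨⟨f, rfl⟩, ih⟩

theorem Unmarked.of_fill {C : Context (L.sum L) V} {t : (L.sum L).Term V}
    (h : Unmarked (C.fill t)) : Unmarked t := by
  induction C with
  | hole => exact h
  | arg f i ts C ih => exact ih (by simpa using h.2 i)

theorem Unmarked.fill {C : Context (L.sum L) V} {s t : (L.sum L).Term V}
    (h : Unmarked (C.fill s)) (ht : Unmarked t) : Unmarked (C.fill t) := by
  induction C with
  | hole => exact ht
  | arg f i ts C ih =>
    refine ⟨h.1, fun j => ?_⟩
    have hj := h.2 j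
    rcases eq_or_ne j i with rfl | hne
    · simpa using ih (by simpa using hj)
    · simpa [hne] using hj

theorem Unmarked.of_subst {t : (L.sum L).Term V} {σ : V → (L.sum L).Term V}
    (h : Unmarked (t.subst σ)) : ∀ x ∈ vars t, Unmarked (σ x) := by
  induction t with
  | var y => rintro x rfl; exact h
  | func f ts ih =>
    intro x hx
    obtain ⟨i, hi⟩ := Set.mem_iUnion.1 hx
    exact ih i (h.2 i) x hi

theorem Unmarked.subst {t : (L.sum L).Term V} {σ : V → (L.sum L).Term V}
    (h : Unmarked t) (hσ : ∀ x ∈ vars t, Unmarked (σ x)) : Unmarked (t.subst σ) := by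
  induction t with
  | var y => exact hσ y rfl
  | func f ts ih =>
    exact ⟨h.1, fun i => ih i (h.2 i) fun x hx => hσ x (Set.mem_iUnion.2 ⟨i, hx⟩)⟩

theorem vars_embed (t : L.Term V) : vars (embed t) = vars t := by
  induction t with
  | var x => rfl
  | func f ts ih =>
    simp only [embed] at ih
    simp [embed, LHom.onTerm, vars, ih]

theorem unmark_subst (t : (L.sum L).Term V) (σ : V → (L.sum L).Term V) :
    unmark (t.subst σ) = (unmark t).subst fun x => unmark (σ x) :=
  onTerm_subst _ _ _

theorem embed_subst (t : L.Term V) (σ : V → L.Term V) :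
    embed (t.subst σ) = (embed t).subst fun x => embed (σ x) :=
  onTerm_subst _ _ _

theorem Rewrites.embed {s t : L.Term V} (h : Rewrites R s t) :
    Rewrites (embedRules R) (embed s) (embed t) :=
  h.onTerm (R' := embedRules R) LHom.sumInl fun ρ hρ => ⟨ρ, hρ, rfl⟩

theorem Rewrites.unmark {s t : (L.sum L).Term V} (h : Rewrites (embedRules R) s t) :
    Rewrites R (unmark s) (unmark t) := by
  refine h.onTerm _ ?_
  rintro _ ⟨ρ, hρ, rfl⟩
  have h₁ := unmark_embed ρ.1
  have h₂ := unmark_embed ρ.2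
  simp only [Rewriting.unmark] at h₁ h₂
  simpa [h₁, h₂] using hρ

/-- A left-hand side with unmarked root cannot match at the marked root, so the step takes place
strictly below it and involves only unmarked symbols. -/
theorem RootMarked.of_rewrites_embedRules (hR : IsTRS R) {s t : (L.sum L).Term V}
    (hs : RootMarked s) (h : Rewrites (embedRules R) s t) : RootMarked t := by
  obtain ⟨C, σ, _, ⟨ρ, hρ, rfl⟩, rfl, rfl⟩ := h
  cases C with
  | hole =>
    obtain ⟨l, r⟩ := ρ
    cases l with
    | var x => exact absurd rfl (hR.lhs_ne_var _ hρ x)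
    | func f ts =>
      obtain ⟨⟨g, hg⟩, -⟩ := hs
      exact absurd hg (by simp [LHom.sumInl])
  | arg f i ts C =>
    refine ⟨hs.1, fun j => ?_⟩
    have hj := hs.2 j
    rcases eq_or_ne j i with rfl | hne
    · simp only [Function.update_self] at hj ⊢
      refine hj.fill ((unmarked_embed _).subst fun x hx => hj.of_fill.of_subst x ?_)
      rw [vars_embed] at hx ⊢
      exact hR.vars_subset _ hρ hx
    · simpa [hne] using hj

/-- A marked left-hand side can only match at the root. Without marks, the step is a root step of
`R` followed by the passage to a subterm. -/
theorem RootMarked.of_rewrites_dependencyPairs (hR : IsTRS R) {s t : (L.sum L).Term V}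
    (hs : RootMarked s) (h : Rewrites (dependencyPairs R) s t) :
    RootMarked t ∧ ∃ t', Rewrites R (unmark s) t' ∧ Subterm (unmark t) t' := by
  obtain ⟨C, σ, _, ⟨ρ, hρ, u, hu, ⟨f, -, hf⟩, -, rfl⟩, rfl, rfl⟩ := h
  have hvars : vars u ⊆ vars ρ.1 := hu.vars_subset.trans (hR.vars_subset _ hρ)
  cases C with
  | hole =>
    simp only [Context.fill] at hs ⊢
    obtain ⟨l, r⟩ := ρ
    constructor
    · cases l with
      | var x => exact absurd rfl (hR.lhs_ne_var _ hρ x)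
      | func g ls =>
        cases u with
        | var x => simp [root] at hf
        | func k us =>
          refine ⟨⟨k, rfl⟩, fun i => (unmarked_embed _).subst fun x hx => ?_⟩
          rw [vars_embed] at hx
          obtain ⟨j, hj⟩ := Set.mem_iUnion.1 (hvars (Set.mem_iUnion.2 ⟨i, hx⟩))
          exact (hs.2 j).of_subst x (by rwa [vars_embed])
    · simp only [unmark_subst, unmark_sharp]
      exact ⟨_, ⟨.hole, _, _, hρ, rfl, rfl⟩, hu.subst _⟩
  | arg g i ts C =>
    have hi := hs.2 i
    simp only [Function.update_self] at hi
    obtain ⟨l, r⟩ := ρ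
    cases l with
    | var x => exact absurd rfl (hR.lhs_ne_var _ hρ x)
    | func k ls =>
      obtain ⟨⟨k', hk⟩, -⟩ := hi.of_fill
      cases hk

/-- A chain of dependency pair steps gives rise to a derivation of at least the same length. -/
theorem dpHeight_le_derivationHeight (hR : IsTRS R) (t : L.Term V) :
    dpHeight R t ≤ derivationHeight (Rewrites R) t := by
  cases t with
  | var x =>
    -- Variables are treated separately, since `sharp` does not mark them; no left-hand side is a
    -- variable, so none can be rewritten.
    refine derivationHeight_le fun n b h => ?_
    cases n with
    | zero => simp
    | succ n =>
      exfalso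
      obtain ⟨c, ⟨a, b, hsa, hab, -⟩, -⟩ := h
      have hvar : ∀ (R' : Set ((L.sum L).Term V × (L.sum L).Term V)) c,
          (∀ ρ ∈ R', ∀ y, ρ.1 ≠ .var y) → ¬ Rewrites R' (.var x) c := by
        intro R' c hR' hc
        rcases hc.cases with ⟨ρ, hρ, σ, h, -⟩ | ⟨n, f, ts, i, t', -, h, -⟩
        · obtain ⟨l, r⟩ := ρ
          cases l with
          | var y => exact hR' _ hρ y rfl
          | func f ts => cases h
        · cases h
      have hsa' : a = .var x := by
        rcases hsa.cases_head with h | ⟨c, hc, -⟩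
        · exact h.symm
        · refine (hvar _ _ ?_ hc).elim
          rintro _ ⟨ρ, hρ, rfl⟩ y
          obtain ⟨l, r⟩ := ρ
          cases l with
          | var y => exact absurd rfl (hR.lhs_ne_var _ hρ y)
          | func f ts => simp [Rewriting.embed, LHom.onTerm]
      subst hsa'
      refine hvar _ _ ?_ hab
      rintro _ ⟨ρ, hρ, u, -, -, -, rfl⟩ y
      obtain ⟨l, r⟩ := ρ
      cases l with
      | var y => exact absurd rfl (hR.lhs_ne_var _ hρ y)
      | func f ts => simp [sharp]
  | func f ts =>
    have hstar : ∀ a b : (L.sum L).Term V, RootMarked a →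
        Relation.ReflTransGen (Rewrites (embedRules R)) a b → RootMarked b ∧
        derivationHeight (Rewrites R) (unmark b) ≤ derivationHeight (Rewrites R) (unmark a) := by
      intro a b ha hab
      induction hab with
      | refl => exact ⟨ha, le_rfl⟩
      | tail _ h ih =>
        exact ⟨ih.1.of_rewrites_embedRules hR h,
          le_self_add.trans ((derivationHeight_add_one_le h.unmark).trans ih.2)⟩
    have hsub : ∀ a b : L.Term V, Subterm a b →
        derivationHeight (Rewrites R) a ≤ derivationHeight (Rewrites R) b := by
      rintro a _ ⟨C, rfl⟩
      exact derivationHeight_le_of_simulation _ (fun _ _ h => h.fill C) a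
    have main : ∀ (n : ℕ) (a b : (L.sum L).Term V), RootMarked a →
        relPow (Relative (Rewrites (dependencyPairs R)) (Rewrites (embedRules R))) n a b →
        (n : ℕ∞) ≤ derivationHeight (Rewrites R) (unmark a) := by
      intro n
      induction n with
      | zero => intros; simp
      | succ n ih =>
        rintro a b ha ⟨c, ⟨a₁, a₂, h₁, h₂, h₃⟩, hcb⟩
        obtain ⟨hm₁, hle₁⟩ := hstar _ _ ha h₁
        obtain ⟨hm₂, t', ht', hsub'⟩ := hm₁.of_rewrites_dependencyPairs hR h₂
        obtain ⟨hm₃, hle₃⟩ := hstar _ _ hm₂ h₃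
        push_cast
        calc (n : ℕ∞) + 1 ≤ derivationHeight (Rewrites R) t' + 1 := by
              gcongr
              exact (ih _ _ hm₃ hcb).trans (hle₃.trans (hsub _ _ hsub'))
          _ ≤ _ := (derivationHeight_add_one_le ht').trans hle₁
    refine derivationHeight_le fun n b h => ?_
    have hmarked : RootMarked (sharp (.func f ts)) := ⟨⟨f, rfl⟩, fun i => unmarked_embed _⟩
    have := main n _ b hmarked h
    rwa [unmark_sharp] at this

theorem dpComplexity_ne_top (hL : IsStringSignature L) (hR : IsTRS R)
    (ht : Terminating (Rewrites R)) (n : ℕ) : dpComplexity R n ≠ ⊤ :=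
  ne_top_of_le_ne_top (derivationalComplexity_ne_top hL hR ht n)
    (iSup₂_mono fun t _ => dpHeight_le_derivationHeight hR t)

theorem dpComplexityOf_le_dpComplexity {s : L.Term V} {n : ℕ} (h : size s ≤ n) :
    dpComplexityOf R s ≤ dpComplexity R n :=
  iSup₂_le fun t ht => le_iSup₂_of_le t (ht.size_le.trans h) le_rfl

theorem dpHeight_ne_top (hR : IsTRS R) (ht : Terminating (Rewrites R)) (t : L.Term V) :
    dpHeight R t ≠ ⊤ :=
  ne_top_of_le_ne_top (derivationHeight_ne_top (finite_successors hR) ht t)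
    (dpHeight_le_derivationHeight hR t)

/-- The step below the root is also a step of `R` on the marked term, and the leading `s*` of the
first relative step absorbs it. -/
theorem dpHeight_le_of_rewrites_arg {n : ℕ} (f : L.Functions n) (i : Fin n)
    (ts : Fin n → L.Term V) {a b : L.Term V} (h : Rewrites R a b) :
    dpHeight R (.func f (Function.update ts i b)) ≤
      dpHeight R (.func f (Function.update ts i a)) := by
  have hsharp : ∀ c, sharp (.func f (Function.update ts i c)) =
      (Context.arg (L := L.sum L) (Sum.inr f) i (fun j => embed (ts j)) .hole).fill (embed c) := by
    intro c
    simp only [sharp, Context.fill]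
    congr 1
    ext1 j
    rcases eq_or_ne j i with rfl | h <;> simp [*]
  refine derivationHeight_mono ?_
  rintro c ⟨d, e, hd, hde, he⟩
  refine ⟨d, e, Relation.ReflTransGen.head ?_ hd, hde, he⟩
  rw [hsharp, hsharp]
  exact h.embed.fill _

theorem dpHeight_add_one_le {ρ : L.Term V × L.Term V} (hρ : ρ ∈ R) {m n : ℕ}
    {f : L.Functions n} {ls : Fin n → L.Term V} (hl : ρ.1 = .func f ls)
    {g : L.Functions m} {us : Fin m → L.Term V} (hu : Subterm (.func g us) ρ.2)
    (hg : ⟨m, g⟩ ∈ definedSymbols R) (hul : ¬ ProperSubterm (.func g us) ρ.1)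
    (σ : V → L.Term V) :
    dpHeight R ((Term.func g us).subst σ) + 1 ≤ dpHeight R (ρ.1.subst σ) := by
  refine derivationHeight_add_one_le ⟨_, _, .refl, ?_, .refl⟩
  refine ⟨.hole, fun x => embed (σ x), _, ⟨ρ, hρ, _, hu, ⟨_, hg, rfl⟩, hul, rfl⟩, ?_, ?_⟩
  · rw [hl]
    simp [Context.fill, sharp, Term.subst, embed_subst]
  · simp [Context.fill, sharp, Term.subst, embed_subst]

end DependencyPairs

/-! ### The weight of a term

A defined symbol that occurs in `t` as the root of the subterm `u` contributes
`2 ^ (d * dpHeight R u)` to the weight of `t`. Every rewrite step decreases the weight, if `2 ^ d`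
exceeds the size of all right-hand sides. -/

section Weight

variable {L : FirstOrder.Language.{u, v}} {V : Type w} {R : Set (L.Term V × L.Term V)}

open Classical in
/-- The weight of a term. -/
noncomputable def weight (R : Set (L.Term V × L.Term V)) (d : ℕ) : L.Term V → ℕ
  | .var _ => 0
  | .func (l := n) f ts =>
    (if (⟨n, f⟩ : Σ n, L.Functions n) ∈ definedSymbols R
      then 2 ^ (d * (dpHeight R (.func f ts)).toNat) else 0) + ∑ i, weight R d (ts i)

theorem weight_arg_le (d : ℕ) {n : ℕ} (f : L.Functions n) (ts : Fin n → L.Term V) (i : Fin n) :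
    weight R d (ts i) ≤ weight R d (.func f ts) := by
  have := Finset.single_le_sum (f := fun i => weight R d (ts i)) (fun _ _ => Nat.zero_le _)
    (Finset.mem_univ i)
  simp only [weight] at *
  omega

theorem Subterm.weight_le {u t : L.Term V} (h : Subterm u t) (d : ℕ) :
    weight R d u ≤ weight R d t := by
  obtain ⟨C, rfl⟩ := h
  induction C with
  | hole => exact le_rfl
  | arg f i ts C ih =>
    have := weight_arg_le (R := R) d f (Function.update ts i (C.fill u)) i
    rw [Function.update_self] at this
    exact ih.trans this

theorem weight_le (d N : ℕ) (t : L.Term V)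
    (h : ∀ u, Subterm u t → (dpHeight R u).toNat ≤ N) :
    weight R d t ≤ size t * 2 ^ (d * N) := by
  induction t with
  | var x => simp [weight]
  | func f ts ih =>
    simp only [weight, size, add_mul, one_mul, Finset.sum_mul]
    refine add_le_add ?_ (Finset.sum_le_sum fun i _ =>
      ih i fun u hu => h u (hu.trans (subterm_arg f ts i)))
    split_ifs
    · exact Nat.pow_le_pow_right (by norm_num) (Nat.mul_le_mul_left _ (h _ (.refl _)))
    · exact Nat.zero_le _

/-- There is at most one summand. This is what excludes duplication: with several arguments, the
weight of the substituted part could be counted repeatedly. -/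
theorem sum_le_of_isStringSignature (hL : IsStringSignature L) {n : ℕ} (f : L.Functions n)
    (a : Fin n → ℕ) (b : ℕ) (h : ∀ i, a i ≤ b) : ∑ i, a i ≤ b := by
  match n, f with
  | 0, _ => simp
  | 1, _ => simpa using h 0
  | n + 2, f => exact ((hL (n + 2) (by omega)).false f).elim

open Classical in
/-- The symbols of a right-hand side that are not part of a subterm of the left-hand side have
small weight. -/
theorem weight_subst_le (hL : IsStringSignature L) (hR : IsTRS R)
    (ht : Terminating (Rewrites R)) (d : ℕ) {ρ : L.Term V × L.Term V} (hρ : ρ ∈ R) {n : ℕ}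
    {f : L.Functions n} {ls : Fin n → L.Term V} (hl : ρ.1 = .func f ls) (σ : V → L.Term V)
    (M : ℕ)
    (hM : ∀ k, k + 1 ≤ (dpHeight R (ρ.1.subst σ)).toNat → 2 ^ (d * k) ≤ M)
    (u : L.Term V) (hu : Subterm u ρ.2) :
    weight R d (u.subst σ) ≤ size u * M + ∑ i, weight R d ((ls i).subst σ) := by
  have hproper : ∀ u, ProperSubterm u ρ.1 →
      weight R d (u.subst σ) ≤ ∑ i, weight R d ((ls i).subst σ) := by
    intro u hu
    rw [hl] at hu
    obtain ⟨i, hi⟩ := hu.exists_arg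
    exact ((hi.subst σ).weight_le d).trans (Finset.single_le_sum
      (f := fun i => weight R d ((ls i).subst σ)) (fun _ _ => Nat.zero_le _) (Finset.mem_univ i))
  induction u with
  | var x =>
    refine (hproper _ ⟨subterm_var_of_mem_vars
      (hR.vars_subset ρ hρ (hu.vars_subset rfl)), ?_⟩).trans (Nat.le_add_left _ _)
    rw [hl]
    simp
  | @func m g us ih =>
    -- The recursion into the right-hand side stops at proper subterms of the left-hand side; above
    -- them, every defined symbol comes from a dependency pair.
    by_cases hp : ProperSubterm (.func g us) ρ.1
    · exact (hproper _ hp).trans (Nat.le_add_left _ _)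
    have hroot : (if (⟨m, g⟩ : Σ n, L.Functions n) ∈ definedSymbols R
        then 2 ^ (d * (dpHeight R ((Term.func g us).subst σ)).toNat) else 0) ≤ M := by
      split_ifs with hg
      · apply hM
        have h := dpHeight_add_one_le hρ hl hu hg hp σ
        rw [← ENat.natCast_toNat (dpHeight_ne_top hR ht (ρ.1.subst σ)),
          ← ENat.natCast_toNat (dpHeight_ne_top hR ht ((Term.func g us).subst σ))] at h
        exact_mod_cast h
      · exact Nat.zero_le _
    have hargs : ∑ i, weight R d ((us i).subst σ) ≤
        (∑ i, size (us i)) * M + ∑ i, weight R d ((ls i).subst σ) := by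
      refine sum_le_of_isStringSignature hL g _ _ fun i =>
        (ih i ((subterm_arg g us i).trans hu)).trans ?_
      gcongr
      exact Finset.single_le_sum (f := fun i => size (us i)) (fun _ _ => Nat.zero_le _)
        (Finset.mem_univ i)
    simp only [Term.subst] at hroot
    simp only [Term.subst, weight, size, add_mul, one_mul]
    rw [add_assoc]
    exact add_le_add hroot hargs

theorem weight_lt_of_rewrites (hL : IsStringSignature L) (hR : IsTRS R)
    (ht : Terminating (Rewrites R)) {d : ℕ} (hd : ∀ ρ ∈ R, size ρ.2 < 2 ^ d)
    {s t : L.Term V} (h : Rewrites R s t) : weight R d t < weight R d s := by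
  obtain ⟨C, σ, ρ, hρ, rfl, rfl⟩ := h
  induction C with
  | hole =>
    simp only [Context.fill]
    obtain ⟨l, r⟩ := ρ
    cases l with
    | var x => exact absurd rfl (hR.lhs_ne_var _ hρ x)
    | @func n f ls =>
      have hf : (⟨n, f⟩ : Σ n, L.Functions n) ∈ definedSymbols R := ⟨_, hρ, rfl⟩
      -- `M` is `2 ^ (d * (k - 1))` for positive `k`. For `k = 0` no dependency pair applies, so the
      -- new symbols weigh nothing and `M = 0` works.
      have hbound : ∀ k, ∃ M, (∀ j, j + 1 ≤ k → 2 ^ (d * j) ≤ M) ∧ size r * M < 2 ^ (d * k) := by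
        rintro (_ | k)
        · exact ⟨0, by simp, by simp⟩
        · refine ⟨2 ^ (d * k), fun j hj => Nat.pow_le_pow_right (by norm_num)
            (Nat.mul_le_mul_left _ (by omega)), ?_⟩
          rw [Nat.mul_succ, pow_add, mul_comm]
          exact Nat.mul_lt_mul_of_pos_left (hd _ hρ) (by positivity)
      obtain ⟨M, hM, hlt⟩ := hbound (dpHeight R ((Term.func f ls).subst σ)).toNat
      refine (weight_subst_le hL hR ht d hρ rfl σ M hM r (.refl _)).trans_lt ?_
      simp only [Term.subst] at hlt
      simp only [Term.subst, weight, hf, if_true]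
      exact Nat.add_lt_add_right hlt _
  | @arg n f i ts C ih =>
    have hstep : Rewrites R (C.fill (ρ.1.subst σ)) (C.fill (ρ.2.subst σ)) :=
      ⟨C, σ, ρ, hρ, rfl, rfl⟩
    simp only [Context.fill, weight]
    refine add_lt_add_of_le_of_lt ?_ ?_
    -- The summand of a symbol above the redex does not increase; the strict decrease comes from the
    -- argument that contains the redex.
    · split_ifs
      · exact Nat.pow_le_pow_right (by norm_num) (Nat.mul_le_mul_left _ (ENat.toNat_le_toNat
          (dpHeight_le_of_rewrites_arg f i ts hstep) (dpHeight_ne_top hR ht _)))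
      · exact le_rfl
    · refine Finset.sum_lt_sum (fun j _ => ?_) ⟨i, Finset.mem_univ i, by simpa using ih⟩
      rcases eq_or_ne j i with rfl | hne
      · simpa using ih.le
      · simp [hne]

/-- Keeping `N` free lets the same `d` serve both the bound for a single term and the bound for all
terms of size at most `n`. -/
theorem exists_derivationHeight_le (hL : IsStringSignature L) (hR : IsTRS R)
    (ht : Terminating (Rewrites R)) : ∃ d : ℕ, ∀ (s : L.Term V) (N : ℕ),
      dpComplexityOf R s ≤ N →
        derivationHeight (Rewrites R) s ≤ ((size s * 2 ^ (d * (N + 1)) : ℕ) : ℕ∞) := by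
  obtain ⟨d, hd⟩ := (hR.finite.image fun ρ => size ρ.2).bddAbove
  refine ⟨d, fun s N hN => ?_⟩
  refine (derivationHeight_le_measure (weight R d) (fun a b hab => weight_lt_of_rewrites hL hR ht
    (fun ρ hρ => (hd ⟨ρ, hρ, rfl⟩).trans_lt Nat.lt_two_pow_self) hab) s).trans ?_
  norm_cast
  refine (weight_le d N s fun u hu => ?_).trans ?_
  · exact ENat.toNat_le_of_le_natCast ((le_iSup₂_of_le u hu le_rfl).trans hN)
  · exact Nat.mul_le_mul_left _ (Nat.pow_le_pow_right (by norm_num)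
      (Nat.mul_le_mul_left _ (Nat.le_succ N)))

end Weight

/-! ### The system `f(s(x)) → s(f(f(x)))` -/

section Exp

theorem isStringSignature_expSignature : IsStringSignature expSignature := by
  intro n hn
  constructor
  intro g
  change ExpSymbol n at g
  cases g <;> omega

theorem isTRS_expSystem : IsTRS expSystem where
  finite := Set.finite_singleton _
  lhs_ne_var := by
    rintro _ rfl x h
    cases h
  vars_subset := by
    rintro _ rfl
    simp [expS, expF, vars]

/-- `1` for the symbol `s`, and `0` for the others. -/
def ExpSymbol.indicatorS : {n : ℕ} → ExpSymbol n → ℕ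
  | _, .s => 1
  | _, _ => 0

/-- `1` for the symbol `f`, and `0` for the others. -/
def ExpSymbol.indicatorF : {n : ℕ} → ExpSymbol n → ℕ
  | _, .f => 1
  | _, _ => 0

/-- The number of occurrences of `s`, marked or not. -/
def countS : (expSignature.sum expSignature).Term ℕ → ℕ
  | .var _ => 0
  | .func g ts => Sum.elim ExpSymbol.indicatorS ExpSymbol.indicatorS g + ∑ i, countS (ts i)

/-- The number of rewrite steps that lead from a term to its normal form. -/
def expSteps : expSignature.Term ℕ → ℕ
  | .var _ => 0
  | .func g ts =>
    ExpSymbol.indicatorF g * (2 ^ (∑ i, countS (embed (ts i))) - 1) + ∑ i, expSteps (ts i)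

/-- The context contributes the same amount whatever fills it; the additive form avoids truncated
subtraction. -/
theorem countS_fill (C : Context (expSignature.sum expSignature) ℕ)
    (a b : (expSignature.sum expSignature).Term ℕ) :
    countS (C.fill a) + countS b = countS (C.fill b) + countS a := by
  induction C with
  | hole => exact add_comm _ _
  | arg g i ts C ih =>
    simp only [Context.fill, countS, ← Finset.add_sum_erase _ _ (Finset.mem_univ i),
      Function.update_self]
    have : ∀ c d, ∑ j ∈ Finset.univ.erase i, countS (Function.update ts i c j) =
        ∑ j ∈ Finset.univ.erase i, countS (Function.update ts i d j) := by
      intro c d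
      refine Finset.sum_congr rfl fun j hj => ?_
      simp [Finset.ne_of_mem_erase hj]
    rw [this (C.fill a) (C.fill b)]
    omega

theorem countS_embed_expS (t : expSignature.Term ℕ) :
    countS (embed (expS t)) = 1 + countS (embed t) := by
  change 1 + ∑ i : Fin 1, countS (embed t) = _
  simp

theorem countS_embed_expF (t : expSignature.Term ℕ) :
    countS (embed (expF t)) = countS (embed t) := by
  change 0 + ∑ i : Fin 1, countS (embed t) = _
  simp

theorem countS_sharp (t : expSignature.Term ℕ) : countS (sharp t) = countS (embed t) := by
  cases t with
  | var x => rfl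
  | func g ts => rfl

theorem countS_embed_le_size (t : expSignature.Term ℕ) : countS (embed t) ≤ size t := by
  induction t with
  | var x => exact Nat.zero_le _
  | @func n g ts ih =>
    change ExpSymbol.indicatorS g + ∑ i, countS (embed (ts i)) ≤ 1 + ∑ i, size (ts i)
    refine add_le_add ?_ (Finset.sum_le_sum fun i _ => ih i)
    change ExpSymbol n at g
    cases g <;> simp [ExpSymbol.indicatorS]

theorem countS_eq_of_rewrites {a b : (expSignature.sum expSignature).Term ℕ}
    (h : Rewrites (embedRules expSystem) a b) : countS b = countS a := by
  obtain ⟨C, σ, _, ⟨_, rfl, rfl⟩, rfl, rfl⟩ := h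
  have h := countS_fill C ((embed (expF (expS (.var 0)))).subst σ)
    ((embed (expS (expF (expF (.var 0))))).subst σ)
  have h₁ : countS ((embed (expF (expS (.var 0)))).subst σ) = 1 + countS (σ 0) := by
    change 0 + ∑ i : Fin 1, (1 + ∑ j : Fin 1, countS (σ 0)) = _
    simp
  have h₂ : countS ((embed (expS (expF (expF (.var 0))))).subst σ) = 1 + countS (σ 0) := by
    change 1 + ∑ i : Fin 1, (0 + ∑ j : Fin 1, (0 + ∑ k : Fin 1, countS (σ 0))) = _
    simp
  simp only at *
  omega

theorem subterm_expS {u t : expSignature.Term ℕ} (h : Subterm u (expS t)) :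
    u = expS t ∨ Subterm u t := by
  by_cases hu : u = expS t
  · exact .inl hu
  · exact .inr (ProperSubterm.exists_arg (ts := fun _ : Fin 1 => t) ⟨h, hu⟩).choose_spec

theorem subterm_expF {u t : expSignature.Term ℕ} (h : Subterm u (expF t)) :
    u = expF t ∨ Subterm u t := by
  by_cases hu : u = expF t
  · exact .inl hu
  · exact .inr (ProperSubterm.exists_arg (ts := fun _ : Fin 1 => t) ⟨h, hu⟩).choose_spec

theorem subterm_var {u : expSignature.Term ℕ} {x : ℕ} (h : Subterm u (.var x)) :
    u = .var x := by
  obtain ⟨C, hC⟩ := h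
  cases C with
  | hole => exact hC
  | arg g i ts C => cases hC

/-- The only candidates for `u` are `f(f(x))` and `f(x)`, and neither contains the `s` of the
left-hand side. -/
theorem countS_lt_of_rewrites {a b : (expSignature.sum expSignature).Term ℕ}
    (h : Rewrites (dependencyPairs expSystem) a b) : countS b < countS a := by
  obtain ⟨C, σ, _, ⟨_, rfl, u, hu, ⟨g, ⟨_, rfl, hg⟩, hug⟩, -, rfl⟩, rfl, rfl⟩ := h
  have h := countS_fill C ((sharp (expF (expS (.var 0)))).subst σ) ((sharp u).subst σ)
  have h₁ : countS ((sharp (expF (expS (.var 0)))).subst σ) = 1 + countS (σ 0) := by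
    change 0 + ∑ i : Fin 1, (1 + ∑ j : Fin 1, countS (σ 0)) = _
    simp
  have h₂ : countS ((sharp u).subst σ) = countS (σ 0) := by
    rw [← hg] at hug
    rcases subterm_expS hu with rfl | hu
    · simp [expS, expF, root] at hug
      cases hug
    rcases subterm_expF hu with rfl | hu
    · change 0 + ∑ i : Fin 1, (0 + ∑ j : Fin 1, countS (σ 0)) = _
      simp
    rcases subterm_expF hu with rfl | hu
    · change 0 + ∑ i : Fin 1, countS (σ 0) = _
      simp
    · cases subterm_var hu
      simp [expF, root] at hug
  simp only at *
  omega

theorem dpComplexity_expSystem_le (n : ℕ) : dpComplexity expSystem n ≤ n := by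
  refine iSup₂_le fun t ht => (derivationHeight_le_measure countS ?_ _).trans ?_
  · have hstar : ∀ a b, Relation.ReflTransGen (Rewrites (embedRules expSystem)) a b →
        countS b = countS a := by
      intro a b h
      induction h with
      | refl => rfl
      | tail _ h ih => rw [countS_eq_of_rewrites h, ih]
    rintro a b ⟨c, d, hac, hcd, hdb⟩
    rw [hstar _ _ hdb, ← hstar _ _ hac]
    exact countS_lt_of_rewrites hcd
  · rw [countS_sharp]
    exact_mod_cast (countS_embed_le_size t).trans ht

/-! ### Termination and exponentially long derivations -/

theorem expSteps_expS (t : expSignature.Term ℕ) : expSteps (expS t) = expSteps t := by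
  change 0 * (2 ^ (∑ i : Fin 1, countS (embed t)) - 1) + ∑ i : Fin 1, expSteps t = _
  simp

theorem expSteps_expF (t : expSignature.Term ℕ) :
    expSteps (expF t) = 2 ^ countS (embed t) - 1 + expSteps t := by
  change 1 * (2 ^ (∑ i : Fin 1, countS (embed t)) - 1) + ∑ i : Fin 1, expSteps t = _
  simp

/-- With `k` symbols `s` below the redex, one `f` contributing `2 ^ (k + 1) - 1` is replaced by two
contributing `2 ^ k - 1` each, a loss of exactly one. Symbols further out are unaffected, because
the number of `s` is invariant. -/
theorem expSteps_lt_of_rewrites {a b : expSignature.Term ℕ} (h : Rewrites expSystem a b) :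
    expSteps b < expSteps a := by
  obtain ⟨C, σ, _, rfl, rfl, rfl⟩ := h
  induction C with
  | hole =>
    change expSteps (expS (expF (expF (σ 0)))) < expSteps (expF (expS (σ 0)))
    simp only [expSteps_expS, expSteps_expF, countS_embed_expS, countS_embed_expF, pow_add]
    have := Nat.one_le_two_pow (n := countS (embed (σ 0)))
    omega
  | @arg n g i ts C ih =>
    have hstep : Rewrites expSystem (C.fill ((expF (expS (.var 0))).subst σ))
        (C.fill ((expS (expF (expF (.var 0)))).subst σ)) := ⟨C, σ, _, rfl, rfl, rfl⟩
    have hcount : ∀ j, countS (embed (Function.update ts i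
        (C.fill ((expS (expF (expF (.var 0)))).subst σ)) j)) = countS (embed (Function.update ts i
        (C.fill ((expF (expS (.var 0))).subst σ)) j)) := by
      intro j
      rcases eq_or_ne j i with rfl | hne
      · simpa using countS_eq_of_rewrites hstep.embed
      · simp [hne]
    simp only [Context.fill, expSteps, hcount]
    refine Nat.add_lt_add_left ?_ _
    refine Finset.sum_lt_sum (fun j _ => ?_) ⟨i, Finset.mem_univ i, by simpa using ih⟩
    rcases eq_or_ne j i with rfl | hne
    · simpa using ih.le
    · simp [hne]

theorem relPow_expS {n : ℕ} {a b : expSignature.Term ℕ} (h : relPow (Rewrites expSystem) n a b) :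
    relPow (Rewrites expSystem) n (expS a) (expS b) := by
  induction n generalizing a with
  | zero => cases h; rfl
  | succ n ih =>
    obtain ⟨c, hac, hcb⟩ := h
    refine ⟨expS c, ?_, ih hcb⟩
    have hfill : ∀ t, (Context.arg (L := expSignature) (n := 1) ExpSymbol.s 0
        (fun _ => .var 0) .hole).fill t = expS t := by
      intro t
      simp only [Context.fill, expS]
      congr 1
      ext1 j
      rw [Subsingleton.elim j 0, Function.update_self]
    rw [← hfill, ← hfill]
    exact hac.fill _

theorem relPow_expF {n : ℕ} {a b : expSignature.Term ℕ} (h : relPow (Rewrites expSystem) n a b) :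
    relPow (Rewrites expSystem) n (expF a) (expF b) := by
  induction n generalizing a with
  | zero => cases h; rfl
  | succ n ih =>
    obtain ⟨c, hac, hcb⟩ := h
    refine ⟨expF c, ?_, ih hcb⟩
    have hfill : ∀ t, (Context.arg (L := expSignature) (n := 1) ExpSymbol.f 0
        (fun _ => .var 0) .hole).fill t = expF t := by
      intro t
      simp only [Context.fill, expF]
      congr 1
      ext1 j
      rw [Subsingleton.elim j 0, Function.update_self]
    rw [← hfill, ← hfill]
    exact hac.fill _

/-- After one step at the root there are two copies of `f` above `n` symbols `s`; the inner one
passes through first, then the outer one. The second pass starts from a new innermost term, hence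
the induction for all `t`. -/
theorem exists_relPow_expF_iterate (n : ℕ) (t : expSignature.Term ℕ) :
    ∃ t', relPow (Rewrites expSystem) (2 ^ n - 1) (expF (expS^[n] t)) (expS^[n] t') := by
  induction n generalizing t with
  | zero => exact ⟨expF t, rfl⟩
  | succ n ih =>
    obtain ⟨t₁, h₁⟩ := ih t
    obtain ⟨t₂, h₂⟩ := ih t₁
    refine ⟨t₂, ?_⟩
    have hlen : 2 ^ (n + 1) - 1 = ((2 ^ n - 1) + (2 ^ n - 1)) + 1 := by
      have := Nat.one_le_two_pow (n := n)
      rw [pow_succ]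
      omega
    rw [hlen, Function.iterate_succ_apply', Function.iterate_succ_apply']
    exact ⟨expS (expF (expF (expS^[n] t))), ⟨.hole, fun _ => expS^[n] t, _, rfl, rfl, rfl⟩,
      relPow_trans (relPow_expS (relPow_expF h₁)) (relPow_expS h₂)⟩

theorem size_expS_iterate (n : ℕ) (t : expSignature.Term ℕ) :
    size (expS^[n] t) = n + size t := by
  induction n with
  | zero => simp
  | succ n ih =>
    rw [Function.iterate_succ_apply']
    simp [expS, size] at ih ⊢
    omega

theorem two_pow_sub_one_le_derivationalComplexity (n : ℕ) :
    ((2 ^ n - 1 : ℕ) : ℕ∞) ≤ derivationalComplexity expSystem (n + 2) := by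
  obtain ⟨t', h⟩ := exists_relPow_expF_iterate n (.var 0)
  refine le_iSup₂_of_le _ ?_ (le_derivationHeight h)
  have := size_expS_iterate n (.var 0)
  simp [expF, size] at this ⊢
  omega

end Exp

end Rewriting

theorem mainTheorem3 :
    -- The upper bound, for every terminating string rewrite system `R`. The first two parts say
    -- that the maxima that define the dependency pair complexity exist.
    (∀ (L : FirstOrder.Language.{u, v}) (V : Type w) (R : Set (L.Term V × L.Term V)),
      Rewriting.IsStringSignature L → Rewriting.IsTRS R →
      Rewriting.Terminating (Rewriting.Rewrites R) →
        (∀ s : L.Term V, Rewriting.dpComplexityOf R s ≠ ⊤) ∧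
        (∀ n : ℕ, Rewriting.dpComplexity R n ≠ ⊤) ∧
        ∃ d : ℕ,
          (∀ s : L.Term V, Rewriting.derivationHeight (Rewriting.Rewrites R) s ≤
            ((Rewriting.size s * 2 ^ (d * ((Rewriting.dpComplexityOf R s).toNat + 1)) : ℕ) : ℕ∞)) ∧
          (∀ n : ℕ, Rewriting.derivationalComplexity R n ≤
            ((n * 2 ^ (d * ((Rewriting.dpComplexity R n).toNat + 1)) : ℕ) : ℕ∞))) ∧
    -- Tightness: a terminating string rewrite system whose dependency pair complexity is at most
    -- linear and whose derivational complexity is at least exponential.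
    (Rewriting.IsStringSignature Rewriting.expSignature ∧
      Rewriting.IsTRS Rewriting.expSystem ∧
      Rewriting.Terminating (Rewriting.Rewrites Rewriting.expSystem) ∧
      (∀ n : ℕ, Rewriting.dpComplexity Rewriting.expSystem n ≤ (n : ℕ∞)) ∧
      (∀ n : ℕ, ((2 ^ n - 1 : ℕ) : ℕ∞) ≤
        Rewriting.derivationalComplexity Rewriting.expSystem (n + 2))) := by
  refine ⟨fun L V R hL hR ht => ?_, Rewriting.isStringSignature_expSignature,
    Rewriting.isTRS_expSystem,
    Rewriting.terminating_of_measure _ fun _ _ => Rewriting.expSteps_lt_of_rewrites,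
    Rewriting.dpComplexity_expSystem_le, Rewriting.two_pow_sub_one_le_derivationalComplexity⟩
  have hn := Rewriting.dpComplexity_ne_top hL hR ht
  have hs : ∀ s : L.Term V, Rewriting.dpComplexityOf R s ≠ ⊤ := fun s =>
    ne_top_of_le_ne_top (hn _) (Rewriting.dpComplexityOf_le_dpComplexity le_rfl)
  obtain ⟨d, hd⟩ := Rewriting.exists_derivationHeight_le hL hR ht
  refine ⟨hs, hn, d, fun s => hd s _ (ENat.natCast_toNat (hs s)).ge, fun n => ?_⟩
  -- Subterms of `t` have size at most `n`, so `N` may be the complexity at `n`, uniformly in `t`.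
  refine iSup₂_le fun t htn => (hd t (Rewriting.dpComplexity R n).toNat ?_).trans ?_
  · rw [ENat.natCast_toNat (hn n)]
    exact Rewriting.dpComplexityOf_le_dpComplexity htn
  · exact_mod_cast Nat.mul_le_mul_right _ htn
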